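/- Let $n \ge 0$ and $d \ge 1$ be integers, let $R=\mathbb{C}[x_0,\dots,x_n]$ with its usual grading, and let $Q=\mathbb{C}[X_0,\dots,X_n]$ act on $R$ by $X_i=\partial/\partial x_i$. For $f\in R_d$ put $\operatorname{Ann}(f)=\{\alpha\in Q : \alpha(f)=0\}$, $A(f)=Q/\operatorname{Ann}(f)$, let $A(f)_k$ be the image of $Q_k$ in $A(f)$, and let $h_k(A(f))=\dim_{\mathbb{C}}A(f)_k$. There is a nonempty Zariski open subset $U'_d$ of the affine space $R_d$ on which the Hilbert vector $(h_0(A(f)),\dots,h_d(A(f)))$ is constant. For every such $U'_d$ and every $f\in U'_d$ one has $$h_k(A(f))=\dim_{\mathbb{C}} Q_k=\binom{n+k}{n}\quad\text{for } 0\le k\le d/2,$$ $$h_k(A(f))=h_{d-k}(A(f))=\binom{n+d-k}{n}\quad\text{for } d/2<k\le d.$$ In particular, if $n\ge 1$ and $d\ge 4$, then the Fermat polynomial $x_0^d+\dots+x_n^d$ does not belong to any such $U'_d$. -/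

import Mathlib

noncomputable section

namespace MacaulayDual

/-- `Poly n` is the ring of complex polynomials in the `n + 1` variables of index `0, …, n`.
It plays two roles: as `R = ℂ[x₀, …, xₙ]` and as the ring `Q = ℂ[X₀, …, Xₙ]` of constant-coefficient
differential operators on `R`. -/
abbrev Poly (n : ℕ) : Type := MvPolynomial (Fin (n + 1)) ℂ

/-- The space of homogeneous polynomials of degree `d` (that is `R_d`, and also `Q_d`). -/
abbrev Form (n d : ℕ) : Submodule ℂ (Poly n) :=
  MvPolynomial.homogeneousSubmodule (Fin (n + 1)) ℂ d

/-- The partial derivative with respect to `x_i`, as a linear endomorphism of `R`. -/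
def partialD (n : ℕ) (i : Fin (n + 1)) : Module.End ℂ (Poly n) :=
  (MvPolynomial.pderiv i : Derivation ℂ (Poly n) (Poly n)).toLinearMap

theorem partialD_comm (n : ℕ) (i j : Fin (n + 1)) :
    partialD n i * partialD n j = partialD n j * partialD n i := by
  have h : ⁅(MvPolynomial.pderiv i : Derivation ℂ (Poly n) (Poly n)),
      (MvPolynomial.pderiv j : Derivation ℂ (Poly n) (Poly n))⁆ = 0 := by
    apply MvPolynomial.derivation_ext
    intro k
    simp only [Derivation.commutator_apply, MvPolynomial.pderiv_X, Derivation.zero_apply]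
    by_cases hi : i = k <;> by_cases hj : j = k <;> simp [hi, hj]
  refine LinearMap.ext fun f => ?_
  have := congrArg (fun D => D f) h
  simpa [partialD, Derivation.commutator_apply, sub_eq_zero] using this

/-- The commutative algebra of differential operators generated by the partial derivatives. -/
abbrev DiffAlg (n : ℕ) : Subalgebra ℂ (Module.End ℂ (Poly n)) :=
  Algebra.adjoin ℂ (Set.range (partialD n))

instance diffAlgCommRing (n : ℕ) : CommRing (DiffAlg n) where
  __ := (inferInstance : Ring (DiffAlg n))
  mul_comm := by
    have := Algebra.isMulCommutative_adjoin ℂ (s := Set.range (partialD n)) (by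
      rintro _ ⟨i, rfl⟩ _ ⟨j, rfl⟩
      exact partialD_comm n i j)
    exact this.is_comm.comm

/-- The action of `Q` on `R`: the algebra homomorphism from `Q` to the linear endomorphisms of `R`
which sends `X_i` to `∂/∂x_i`. -/
def diffOp (n : ℕ) : Poly n →ₐ[ℂ] Module.End ℂ (Poly n) :=
  (DiffAlg n).val.comp
    (MvPolynomial.aeval fun i => (⟨partialD n i, Algebra.subset_adjoin ⟨i, rfl⟩⟩ : DiffAlg n))

theorem diffOp_X (n : ℕ) (i : Fin (n + 1)) (f : Poly n) :
    diffOp n (MvPolynomial.X i) f = MvPolynomial.pderiv i f := by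
  simp [diffOp, partialD]

/-- The annihilator ideal `Ann(f) = {α ∈ Q | α(f) = 0}`. -/
def Ann {n : ℕ} (f : Poly n) : Ideal (Poly n) where
  carrier := {α | diffOp n α f = 0}
  zero_mem' := by simp
  add_mem' := by
    intro a b ha hb
    simp_all
  smul_mem' := by
    intro c a ha
    simp_all

/-- The algebra `A(f) = Q / Ann(f)`. -/
abbrev A {n : ℕ} (f : Poly n) : Type := Poly n ⧸ Ann f

/-- The graded piece `A(f)_k`: the image of `Q_k` in `A(f)`. -/
def gradedPiece {n : ℕ} (f : Poly n) (k : ℕ) : Submodule ℂ (A f) :=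
  (Form n k).map (Ideal.Quotient.mkₐ ℂ (Ann f)).toLinearMap

/-- `h_k(A(f)) = dim A(f)_k`. -/
def h {n : ℕ} (k : ℕ) (f : Poly n) : ℕ := Module.finrank ℂ (gradedPiece f k)

/-- The Hilbert vector `(h_0(A(f)), …, h_d(A(f)))` of a form `f` of degree `d`. -/
def hilb {n d : ℕ} (f : Form n d) : Fin (d + 1) → ℕ := fun k => h k (f : Poly n)

/-- `U` is Zariski open in the affine space `R_d`: its complement is the set of common zeros of a
family of polynomials in the coefficients of a form of degree `d`. -/
def IsZariskiOpen {n d : ℕ} (U : Set (Form n d)) : Prop :=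
  ∃ S : Set (MvPolynomial {m : Fin (n + 1) →₀ ℕ // m.degree = d} ℂ),
    Uᶜ = {f : Form n d | ∀ P ∈ S, MvPolynomial.eval (fun m => (f : Poly n).coeff m.1) P = 0}

/-- The defining property of the set `U'_d`: a nonempty Zariski open subset of `R_d` on which the
Hilbert vector of `A(f)` is constant. -/
structure IsHilbertOpen {n d : ℕ} (U : Set (Form n d)) : Prop where
  isOpen : IsZariskiOpen U
  nonempty : U.Nonempty
  constant : ∀ f ∈ U, ∀ g ∈ U, hilb f = hilb g

/-- The Fermat polynomial `x₀^d + ⋯ + xₙ^d`. -/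
def fermat (n d : ℕ) : Form n d :=
  ⟨∑ i : Fin (n + 1), MvPolynomial.X i ^ d,
    Submodule.sum_mem _ fun i _ => MvPolynomial.isHomogeneous_X_pow i d⟩

end MacaulayDual

end

noncomputable section

namespace MacaulayDual

open MvPolynomial

/-! For `f` of degree `d`, `h k f` is the rank of the pairing `(α, β) ↦ (βα)(f)` on `Q_k × Q_(d-k)`
(`h_eq_finrank_catalecticant`); equality of row and column rank gives the symmetry `h_symm`. For `2k
≤ d`, the rank is full as soon as the square minor obtained by restricting `β` to `X₀^(d-2k) Q_k` is
nonzero, which is an open condition on `f`.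

The minor is not identically zero: pairing with `gridForm` sums values over positive real points, so
a kernel vector `α`, paired with its complex conjugate, gives a vanishing sum of positive multiples
of `|α(p)|²`; then `α` vanishes on a grid too large for its degree
(`det_hankelAt_gridForm_ne_zero`). Since nonempty Zariski open sets meet, every admissible `U` has
this maximal Hilbert vector. The Fermat form misses it in degree 2, being killed by `X₀ Xₙ`. -/

/-! ### The apolarity pairing -/

/-- The product of the factorials of the exponents. -/
def expFactorial {n : ℕ} (m : Fin (n + 1) →₀ ℕ) : ℂ := ∏ i, ((m i).factorial : ℂ)

theorem expFactorial_ne_zero {n : ℕ} (m : Fin (n + 1) →₀ ℕ) : expFactorial m ≠ 0 :=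
  Finset.prod_ne_zero_iff.2 fun _ _ => Nat.cast_ne_zero.2 (Nat.factorial_ne_zero _)

theorem expFactorial_zero {n : ℕ} : expFactorial (0 : Fin (n + 1) →₀ ℕ) = 1 := by
  simp [expFactorial]

theorem expFactorial_add_single {n : ℕ} (m : Fin (n + 1) →₀ ℕ) (i : Fin (n + 1)) :
    expFactorial (m + Finsupp.single i 1) = (m i + 1) * expFactorial m := by
  unfold expFactorial
  rw [← Finset.mul_prod_erase _ _ (Finset.mem_univ i),
    ← Finset.mul_prod_erase Finset.univ (fun j => ((m j).factorial : ℂ)) (Finset.mem_univ i),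
    ← mul_assoc]
  congr 1
  · simp [Nat.factorial_succ]
  · refine Finset.prod_congr rfl fun j hj => ?_
    simp [Finsupp.single_eq_of_ne (Finset.ne_of_mem_erase hj)]

theorem diffOp_mul_apply (n : ℕ) (α β f : Poly n) :
    diffOp n (α * β) f = diffOp n α (diffOp n β f) := by
  rw [map_mul, Module.End.mul_apply]

/-- The formula is stable under composing operators, so it reduces to a single derivative.
Multiplying by `expFactorial l` avoids division. -/
theorem coeff_diffOp_monomial {n : ℕ} (m l : Fin (n + 1) →₀ ℕ) (f : Poly n) :
    coeff l (diffOp n (monomial m 1) f) * expFactorial l =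
      expFactorial (l + m) * coeff (l + m) f := by
  have hadd : ∀ a b : Fin (n + 1) →₀ ℕ,
      (∀ l f, coeff l (diffOp n (monomial a 1) f) * expFactorial l =
        expFactorial (l + a) * coeff (l + a) f) →
      (∀ l f, coeff l (diffOp n (monomial b 1) f) * expFactorial l =
        expFactorial (l + b) * coeff (l + b) f) →
      ∀ l f, coeff l (diffOp n (monomial (a + b) 1) f) * expFactorial l =
        expFactorial (l + (a + b)) * coeff (l + (a + b)) f := by
    intro a b ha hb l f
    have : monomial (a + b) (1 : ℂ) = monomial a 1 * monomial b 1 := by simp [monomial_mul]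
    rw [this, diffOp_mul_apply, ha, mul_comm, hb, add_assoc]
  have hzero : ∀ (l : Fin (n + 1) →₀ ℕ) (f : Poly n),
      coeff l (diffOp n (monomial 0 1) f) * expFactorial l =
        expFactorial (l + 0) * coeff (l + 0) f := by
    intro l f
    have : monomial (0 : Fin (n + 1) →₀ ℕ) (1 : ℂ) = 1 := rfl
    rw [this, map_one, Module.End.one_apply, add_zero, mul_comm]
  induction m using Finsupp.induction_linear generalizing l f with
  | zero => exact hzero l f
  | add a b ha hb => exact hadd a b (fun l f => ha l f) (fun l f => hb l f) l f
  | single i k =>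
    induction k generalizing l f with
    | zero => simpa using hzero l f
    | succ k ih =>
      rw [Finsupp.single_add]
      refine hadd _ _ (fun l f => ih l f) (fun l f => ?_) l f
      rw [show monomial (Finsupp.single i 1) (1 : ℂ) = X i from rfl, diffOp_X, coeff_pderiv,
        expFactorial_add_single]
      ring

/-- The apolarity pairing: the constant coefficient of `α(f)`. -/
def apolar (n : ℕ) : Poly n →ₗ[ℂ] Poly n →ₗ[ℂ] ℂ :=
  LinearMap.mk₂ ℂ (fun α f => coeff 0 (diffOp n α f)) (by simp) (by simp) (by simp) (by simp)

theorem apolar_apply {n : ℕ} (α f : Poly n) : apolar n α f = coeff 0 (diffOp n α f) := rfl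

theorem apolar_monomial {n : ℕ} (m : Fin (n + 1) →₀ ℕ) (f : Poly n) :
    apolar n (monomial m 1) f = expFactorial m * coeff m f := by
  simpa [expFactorial_zero, apolar_apply] using coeff_diffOp_monomial m 0 f

theorem apolar_eq_sum {n : ℕ} (α f : Poly n) :
    apolar n α f = ∑ m ∈ α.support, coeff m α * (expFactorial m * coeff m f) := by
  conv_lhs => rw [α.as_sum]
  rw [map_sum, LinearMap.sum_apply]
  refine Finset.sum_congr rfl fun m _ => ?_
  rw [← apolar_monomial, ← smul_eq_mul, ← LinearMap.smul_apply, ← map_smul, smul_monomial]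
  simp

theorem apolar_eq_zero_of_ne {n d e : ℕ} {α f : Poly n} (hα : α.IsHomogeneous e)
    (hf : f.IsHomogeneous d) (h : e ≠ d) : apolar n α f = 0 := by
  rw [apolar_eq_sum]
  refine Finset.sum_eq_zero fun m hm => ?_
  have : m.degree = e := by
    rw [Finsupp.degree_eq_weight_one]; exact hα (mem_support_iff.1 hm)
  rw [hf.coeff_eq_zero (by rw [this]; exact h)]
  simp

theorem mem_Ann_iff {n : ℕ} {f α : Poly n} : α ∈ Ann f ↔ diffOp n α f = 0 := Iff.rfl

/-- Up to a nonzero factorial, each coefficient of `α(f)` is the pairing of `f` with a monomial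
times `α`; monomials of degree other than `d - k` contribute zero. -/
theorem mem_Ann_iff_apolar {n d k : ℕ} {f α : Poly n} (hf : f.IsHomogeneous d)
    (hα : α.IsHomogeneous k) (hk : k ≤ d) :
    α ∈ Ann f ↔ ∀ β : Form n (d - k), apolar n (β * α) f = 0 := by
  rw [mem_Ann_iff]
  constructor
  · intro h β
    rw [apolar_apply, diffOp_mul_apply, h, map_zero, coeff_zero]
  · intro h
    ext l
    have key : apolar n (monomial l 1 * α) f = 0 := by
      by_cases hl : l.degree = d - k
      · exact h ⟨monomial l 1, isHomogeneous_monomial 1 hl⟩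
      · exact apolar_eq_zero_of_ne ((isHomogeneous_monomial 1 rfl).mul hα) hf (by omega)
    rw [apolar_apply, diffOp_mul_apply, ← apolar_apply, apolar_monomial] at key
    simpa using (mul_eq_zero.1 key).resolve_left (expFactorial_ne_zero l)

/-! ### Catalecticants and the symmetry of the Hilbert vector -/

/-- The catalecticant pairing of `f` on `Q_k × Q_l`. -/
def catalecticant {n : ℕ} (f : Poly n) (k l : ℕ) : Form n k →ₗ[ℂ] Form n l →ₗ[ℂ] ℂ :=
  LinearMap.mk₂ ℂ (fun α β => apolar n ((β : Poly n) * α) f)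
    (by simp [mul_add]) (by simp) (by simp [add_mul]) (by simp)

theorem catalecticant_apply {n : ℕ} (f : Poly n) {k l : ℕ} (α : Form n k) (β : Form n l) :
    catalecticant f k l α β = apolar n ((β : Poly n) * α) f := rfl

theorem catalecticant_flip {n : ℕ} (f : Poly n) (k l : ℕ) :
    (catalecticant f k l).flip = catalecticant f l k := by
  ext α β
  simp [catalecticant_apply, mul_comm]

instance form_finite (n k : ℕ) : Module.Finite ℂ (Form n k) :=
  Module.Finite.iff_fg.2 (homogeneousSubmodule_fg (Fin (n + 1)) ℂ k)

/-- Under the identification of `W` with its bidual, `B.flip` is the transpose of `B`. -/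
theorem finrank_range_flip {V W : Type*} [AddCommGroup V] [Module ℂ V] [AddCommGroup W]
    [Module ℂ W] [FiniteDimensional ℂ V] [FiniteDimensional ℂ W] (B : V →ₗ[ℂ] W →ₗ[ℂ] ℂ) :
    Module.finrank ℂ (LinearMap.range B.flip) = Module.finrank ℂ (LinearMap.range B) := by
  rw [← LinearMap.finrank_range_dualMap_eq_finrank_range B]
  have : B.flip = LinearMap.dualMap B ∘ₗ (Module.evalEquiv ℂ W).toLinearMap := by
    ext; simp
  rw [this, LinearMap.range_comp_of_range_eq_top _ (LinearEquiv.range _)]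

/-- The projection `Q_k → A(f)`. -/
def formToA {n : ℕ} (f : Poly n) (k : ℕ) : Form n k →ₗ[ℂ] A f :=
  (Ideal.Quotient.mkₐ ℂ (Ann f)).toLinearMap ∘ₗ (Form n k).subtype

theorem range_formToA {n : ℕ} (f : Poly n) (k : ℕ) :
    LinearMap.range (formToA f k) = gradedPiece f k := by
  rw [formToA, LinearMap.range_comp, Submodule.range_subtype, gradedPiece]

theorem formToA_eq_zero {n k : ℕ} {f : Poly n} {α : Form n k} :
    formToA f k α = 0 ↔ (α : Poly n) ∈ Ann f := by
  simp [formToA, Ideal.Quotient.eq_zero_iff_mem]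

theorem h_add_finrank_ker {n : ℕ} (f : Poly n) (k : ℕ) :
    h k f + Module.finrank ℂ (LinearMap.ker (formToA f k)) = Module.finrank ℂ (Form n k) := by
  rw [h, ← range_formToA]
  exact LinearMap.finrank_range_add_finrank_ker _

theorem h_eq_finrank_catalecticant {n d k : ℕ} {f : Poly n} (hf : f.IsHomogeneous d)
    (hk : k ≤ d) : h k f = Module.finrank ℂ (LinearMap.range (catalecticant f k (d - k))) := by
  have hker : LinearMap.ker (formToA f k) = LinearMap.ker (catalecticant f k (d - k)) := by
    ext α
    rw [LinearMap.mem_ker, LinearMap.mem_ker, formToA_eq_zero, mem_Ann_iff_apolar hf α.2 hk,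
      LinearMap.ext_iff]
    rfl
  have h1 := h_add_finrank_ker f k
  have h2 := LinearMap.finrank_range_add_finrank_ker (catalecticant f k (d - k))
  rw [hker] at h1
  omega

theorem h_symm {n d k : ℕ} {f : Poly n} (hf : f.IsHomogeneous d) (hk : k ≤ d) :
    h k f = h (d - k) f := by
  rw [h_eq_finrank_catalecticant hf hk, h_eq_finrank_catalecticant hf (Nat.sub_le d k),
    Nat.sub_sub_self hk, ← catalecticant_flip, finrank_range_flip]

theorem h_eq_finrank_iff {n k : ℕ} {f : Poly n} :
    h k f = Module.finrank ℂ (Form n k) ↔ ∀ α : Form n k, (α : Poly n) ∈ Ann f → α = 0 := by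
  have h1 := h_add_finrank_ker f k
  have h2 : Module.finrank ℂ (LinearMap.ker (formToA f k)) = 0 ↔
      ∀ α : Form n k, (α : Poly n) ∈ Ann f → α = 0 := by
    rw [Submodule.finrank_eq_zero, LinearMap.ker_eq_bot']
    simp only [formToA_eq_zero]
  rw [← h2]
  omega

/-! ### Coefficient coordinates and Zariski open sets -/

/-- The exponents of the monomials of degree `d`. -/
abbrev Expo (n d : ℕ) : Type := {m : Fin (n + 1) →₀ ℕ // m.degree = d}

instance expoFintype (n d : ℕ) : Fintype (Expo n d) :=
  (Finsupp.finite_of_degree_eq (σ := Fin (n + 1)) d).fintype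

instance expoDecidableEq (n d : ℕ) : DecidableEq (Expo n d) := Classical.decEq _

theorem card_expo (n d : ℕ) : Fintype.card (Expo n d) = (n + d).choose n := by
  classical
  rw [Fintype.card_of_subtype (Finset.finsuppAntidiag Finset.univ d)
    (by simp [Finset.mem_finsuppAntidiag, Finsupp.degree_eq_sum]),
    Finset.card_finsuppAntidiag_nat_eq_choose]
  rw [Finset.card_univ, Fintype.card_fin, show n + 1 + d - 1 = n + d by omega,
    Nat.choose_symm_add]

theorem form_eq_sum {n d : ℕ} {f : Poly n} (hf : f.IsHomogeneous d) :
    f = ∑ m : Expo n d, monomial m.1 (coeff m.1 f) := by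
  classical
  ext l
  simp only [coeff_sum, coeff_monomial]
  by_cases hl : l.degree = d
  · rw [Finset.sum_eq_single (⟨l, hl⟩ : Expo n d)]
    · simp
    · intro b _ hb
      exact if_neg fun h => hb (Subtype.ext h)
    · simp
  · rw [hf.coeff_eq_zero hl, Finset.sum_eq_zero]
    intro b _
    exact if_neg fun hbl : b.1 = l => hl (hbl ▸ b.2)

/-- The form with prescribed coefficients. -/
def formOfCoeff {n d : ℕ} (a : Expo n d → ℂ) : Form n d :=
  ⟨∑ m, monomial m.1 (a m), Submodule.sum_mem _ fun m _ => isHomogeneous_monomial _ m.2⟩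

theorem coeff_formOfCoeff {n d : ℕ} (a : Expo n d → ℂ) (m : Expo n d) :
    coeff m.1 (formOfCoeff a : Poly n) = a m := by
  classical
  simp only [formOfCoeff, coeff_sum, coeff_monomial]
  rw [Finset.sum_eq_single m]
  · simp
  · intro b _ hb
    exact if_neg fun h => hb (Subtype.ext h)
  · simp

theorem formOfCoeff_coeff {n d : ℕ} (f : Form n d) :
    formOfCoeff (fun m => coeff m.1 (f : Poly n)) = f :=
  Subtype.ext (form_eq_sum f.2).symm

/-- Forms of degree `d` are identified with their coefficient vectors. -/
def formEquiv (n d : ℕ) : Form n d ≃ₗ[ℂ] (Expo n d → ℂ) where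
  toFun f m := coeff m.1 (f : Poly n)
  map_add' f g := by ext; simp
  map_smul' c f := by ext; simp
  invFun := formOfCoeff
  left_inv := formOfCoeff_coeff
  right_inv a := funext (coeff_formOfCoeff a)

theorem finrank_form (n d : ℕ) : Module.finrank ℂ (Form n d) = (n + d).choose n := by
  rw [(formEquiv n d).finrank_eq, Module.finrank_fintype_fun_eq_card, card_expo]

/-- Nonempty Zariski open sets meet. -/
theorem IsZariskiOpen.inter_nonempty {n d : ℕ} {U V : Set (Form n d)} (hU : IsZariskiOpen U)
    (hV : IsZariskiOpen V) (hU' : U.Nonempty) (hV' : V.Nonempty) : (U ∩ V).Nonempty := by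
  have key : ∀ W : Set (Form n d), IsZariskiOpen W → W.Nonempty →
      ∃ P : MvPolynomial (Expo n d) ℂ, P ≠ 0 ∧
        ∀ f : Form n d, eval (fun m => coeff m.1 (f : Poly n)) P ≠ 0 → f ∈ W := by
    rintro W ⟨S, hS⟩ ⟨f, hf⟩
    have hf' : f ∉ Wᶜ := fun h => h hf
    rw [hS] at hf'
    simp only [Set.mem_ofPred_eq, not_forall] at hf'
    obtain ⟨P, hP, hne⟩ := hf'
    refine ⟨P, fun h0 => hne (by rw [h0, map_zero]), fun g hg => ?_⟩
    by_contra hgW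
    have : g ∈ Wᶜ := hgW
    rw [hS] at this
    exact hg (this P hP)
  obtain ⟨P, hP, hPU⟩ := key U hU hU'
  obtain ⟨P', hP', hPV⟩ := key V hV hV'
  -- A nonzero polynomial over an infinite field has a nonzero value.
  obtain ⟨a, ha⟩ : ∃ a, eval a (P * P') ≠ 0 := by
    by_contra! hcon
    exact mul_ne_zero hP hP' (MvPolynomial.funext fun a => by simpa using hcon a)
  rw [map_mul] at ha
  have hcoeff : (fun m : Expo n d => coeff m.1 (formOfCoeff a : Poly n)) = a :=
    funext (coeff_formOfCoeff a)
  exact ⟨formOfCoeff a, hPU _ (by rw [hcoeff]; exact left_ne_zero_of_mul ha),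
    hPV _ (by rw [hcoeff]; exact right_ne_zero_of_mul ha)⟩

/-! ### A maximal minor of the catalecticant -/

/-- The sum of two exponents of degree `k`, completed to degree `d` by a power of `X₀`. -/
def hankelExpo {n d k : ℕ} (hk : 2 * k ≤ d) (a b : Expo n k) : Expo n d :=
  ⟨Finsupp.single 0 (d - 2 * k) + a.1 + b.1, by
    rw [map_add, map_add, a.2, b.2, Finsupp.degree_single]; omega⟩

/-- The square submatrix of the generic catalecticant matrix on `Q_k × X₀^(d-2k) Q_k`. -/
def hankel {n d k : ℕ} (hk : 2 * k ≤ d) :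
    Matrix (Expo n k) (Expo n k) (MvPolynomial (Expo n d) ℂ) :=
  Matrix.of fun a b => C (expFactorial (hankelExpo hk a b).1) * X (hankelExpo hk a b)

/-- The value of the matrix `hankel` at a form. -/
def hankelAt {n d k : ℕ} (hk : 2 * k ≤ d) (f : Form n d) : Matrix (Expo n k) (Expo n k) ℂ :=
  (hankel hk).map (eval fun m => coeff m.1 (f : Poly n))

theorem hankelAt_apply {n d k : ℕ} (hk : 2 * k ≤ d) (f : Form n d) (a b : Expo n k) :
    hankelAt hk f a b =
      apolar n (X 0 ^ (d - 2 * k) * monomial a.1 1 * monomial b.1 1) f := by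
  have : (X 0 ^ (d - 2 * k) * monomial a.1 1 * monomial b.1 1 : Poly n) =
      monomial (hankelExpo hk a b).1 1 := by
    simp [X_pow_eq_monomial, monomial_mul, hankelExpo]
  rw [this, apolar_monomial]
  simp [hankelAt, hankel]

theorem hankelAt_mulVec {n d k : ℕ} (hk : 2 * k ≤ d) (f : Form n d) (α : Form n k)
    (a : Expo n k) :
    (hankelAt hk f).mulVec (formEquiv n k α) a =
      apolar n (X 0 ^ (d - 2 * k) * monomial a.1 1 * (α : Poly n)) f := by
  conv_rhs => rw [form_eq_sum α.2]
  rw [Finset.mul_sum, map_sum, LinearMap.sum_apply]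
  refine Finset.sum_congr rfl fun b _ => ?_
  have : monomial b.1 (coeff b.1 (α : Poly n)) =
      coeff b.1 (α : Poly n) • monomial b.1 (1 : ℂ) := by simp [smul_monomial]
  change hankelAt hk f a b * coeff b.1 (α : Poly n) = _
  rw [hankelAt_apply, this, mul_smul_comm, map_smul, LinearMap.smul_apply, smul_eq_mul, mul_comm]

/-- The coefficient vector of any `α` in `Ann f` lies in the kernel of the matrix. -/
theorem h_eq_finrank_of_det_ne_zero {n d k : ℕ} (hk : 2 * k ≤ d) (f : Form n d)
    (hdet : (hankelAt hk f).det ≠ 0) : h k (f : Poly n) = Module.finrank ℂ (Form n k) := by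
  rw [h_eq_finrank_iff]
  intro α hα
  apply (formEquiv n k).injective
  rw [map_zero]
  refine Matrix.eq_zero_of_mulVec_eq_zero hdet (funext fun a => ?_)
  rw [hankelAt_mulVec, apolar_apply, diffOp_mul_apply, mem_Ann_iff.1 hα]
  simp

/-! ### A form at which every minor is nonzero -/

/-- The points of the grid `{1, …, d + 1}^(n + 1)`. -/
def gridPoint {n d : ℕ} (p : Fin (n + 1) → Fin (d + 1)) : Fin (n + 1) → ℂ :=
  fun i => ((p i : ℕ) : ℂ) + 1

/-- The form (up to a scalar, a sum of `d`-th powers of linear forms) whose apolarity pairing is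
the sum of the values over the grid. -/
def gridForm (n d : ℕ) : Form n d :=
  formOfCoeff fun m =>
    (∑ p : Fin (n + 1) → Fin (d + 1), eval (gridPoint p) (monomial m.1 1)) / expFactorial m.1

theorem apolar_gridForm {n d : ℕ} {α : Poly n} (hα : α.IsHomogeneous d) :
    apolar n α (gridForm n d) =
      ∑ p : Fin (n + 1) → Fin (d + 1), eval (gridPoint p) α := by
  have hmon : ∀ m : Expo n d, apolar n (monomial m.1 1) (gridForm n d) =
      ∑ p : Fin (n + 1) → Fin (d + 1), eval (gridPoint p) (monomial m.1 1) := by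
    intro m
    rw [apolar_monomial, gridForm, coeff_formOfCoeff, mul_div_cancel₀ _ (expFactorial_ne_zero _)]
  rw [form_eq_sum hα]
  simp only [map_sum, LinearMap.sum_apply]
  rw [Finset.sum_comm]
  refine Finset.sum_congr rfl fun m _ => ?_
  have : monomial m.1 (coeff m.1 α) = coeff m.1 α • monomial m.1 (1 : ℂ) := by
    simp [smul_monomial]
  rw [this, map_smul, LinearMap.smul_apply, hmon, Finset.smul_sum]
  simp [smul_eval]

/-- The degree in each variable is at most `d`, below the `d + 1` nodes available. -/
theorem eq_zero_of_eval_gridPoint {n d k : ℕ} (hk : k ≤ d) {α : Poly n} (hα : α.IsHomogeneous k)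
    (h0 : ∀ p : Fin (n + 1) → Fin (d + 1), eval (gridPoint p) α = 0) : α = 0 := by
  classical
  have hinj : Function.Injective fun j : Fin (d + 1) => ((j : ℕ) : ℂ) + 1 := by
    intro a b hab
    have : ((a : ℕ) : ℂ) = (b : ℕ) := add_right_cancel hab
    exact Fin.ext (Nat.cast_injective this)
  refine eq_zero_of_eval_zero_at_prod_finset α
    (fun _ => Finset.univ.image fun j : Fin (d + 1) => ((j : ℕ) : ℂ) + 1) (fun i => ?_) ?_
  · rw [Finset.card_image_of_injective _ hinj, Finset.card_univ, Fintype.card_fin]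
    have := (degreeOf_le_totalDegree α i).trans hα.totalDegree_le
    omega
  · intro x hx
    simp only [Finset.mem_image, Finset.mem_univ, true_and] at hx
    choose p hp using hx
    have : gridPoint p = x := funext hp
    rw [← this]
    exact h0 p

theorem eval_gridPoint_map_conj {n d : ℕ} (p : Fin (n + 1) → Fin (d + 1)) (α : Poly n) :
    eval (gridPoint p) (map (starRingEnd ℂ) α) = starRingEnd ℂ (eval (gridPoint p) α) := by
  have hp : starRingEnd ℂ ∘ gridPoint p = gridPoint p := by
    funext i
    simp [gridPoint]
  rw [MvPolynomial.eval₂_comp, hp, eval_map]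

theorem det_hankelAt_gridForm_ne_zero {n d k : ℕ} (hk : 2 * k ≤ d) :
    (hankelAt hk (gridForm n d)).det ≠ 0 := by
  intro hdet
  obtain ⟨v, hv0, hv⟩ := Matrix.exists_mulVec_eq_zero_iff.2 hdet
  obtain ⟨α, rfl⟩ := (formEquiv n k).surjective v
  apply hv0
  have hα : (α : Poly n).IsHomogeneous k := α.2
  have hbar : (map (starRingEnd ℂ) (α : Poly n)).IsHomogeneous k := hα.map _
  -- By linearity, the rows of the kernel equation, indexed by monomials, extend to all `β` of
  -- degree `k`, in particular to the conjugate of `α`.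
  have hpair : ∀ β : Poly n, β.IsHomogeneous k →
      apolar n (X 0 ^ (d - 2 * k) * β * (α : Poly n)) (gridForm n d) = 0 := by
    intro β hβ
    rw [form_eq_sum hβ]
    simp only [Finset.mul_sum, Finset.sum_mul, map_sum, LinearMap.sum_apply]
    refine Finset.sum_eq_zero fun m _ => ?_
    have : monomial m.1 (coeff m.1 β) = coeff m.1 β • monomial m.1 (1 : ℂ) := by
      simp [smul_monomial]
    rw [this, mul_smul_comm, smul_mul_assoc, map_smul, LinearMap.smul_apply, ← hankelAt_mulVec hk,
      hv]
    simp
  have hzero := hpair _ hbar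
  have hdeg : (X 0 ^ (d - 2 * k) * map (starRingEnd ℂ) (α : Poly n) * (α : Poly n)).IsHomogeneous d := by
    have := ((isHomogeneous_X_pow (R := ℂ) (0 : Fin (n + 1)) (d - 2 * k)).mul hbar).mul hα
    rwa [show d - 2 * k + k + k = d by omega] at this
  rw [apolar_gridForm hdeg] at hzero
  have hterm : ∀ p : Fin (n + 1) → Fin (d + 1),
      eval (gridPoint p) (X 0 ^ (d - 2 * k) * map (starRingEnd ℂ) (α : Poly n) * (α : Poly n)) =
        (((((p 0 : ℕ) : ℝ) + 1) ^ (d - 2 * k) *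
          Complex.normSq (eval (gridPoint p) (α : Poly n)) : ℝ) : ℂ) := by
    intro p
    rw [map_mul, map_mul, map_pow, eval_X, eval_gridPoint_map_conj, mul_assoc,
      mul_comm (starRingEnd ℂ _), Complex.mul_conj]
    simp [gridPoint]
  simp only [hterm] at hzero
  rw [← Complex.ofReal_sum, Complex.ofReal_eq_zero,
    Finset.sum_eq_zero_iff_of_nonneg fun p _ => mul_nonneg (by positivity)
      (Complex.normSq_nonneg _)] at hzero
  have hα0 : (α : Poly n) = 0 := by
    refine eq_zero_of_eval_gridPoint (d := d) (by omega) hα fun p => ?_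
    -- The grid starts at 1 rather than 0 so that this weight never vanishes.
    have hpos : (0 : ℝ) < (((p 0 : ℕ) : ℝ) + 1) ^ (d - 2 * k) := by positivity
    exact Complex.normSq_eq_zero.1
      ((mul_eq_zero.1 (hzero p (Finset.mem_univ p))).resolve_left hpos.ne')
  rw [show α = 0 from Subtype.ext hα0, map_zero]

/-! ### The generic Hilbert vector -/

/-- The product of the determinants of the generic matrices `hankel` for `k ≤ d / 2`. -/
def hankelDet (n d : ℕ) : MvPolynomial (Expo n d) ℂ :=
  ∏ k : Fin (d / 2 + 1), (hankel (n := n) (show 2 * (k : ℕ) ≤ d by omega)).det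

theorem eval_hankelDet {n d : ℕ} (f : Form n d) :
    eval (fun m => coeff m.1 (f : Poly n)) (hankelDet n d) =
      ∏ k : Fin (d / 2 + 1), (hankelAt (show 2 * (k : ℕ) ≤ d by omega) f).det := by
  rw [hankelDet, map_prod]
  refine Finset.prod_congr rfl fun k _ => ?_
  rw [RingHom.map_det]
  rfl

/-- The forms at which `hankelDet` does not vanish. -/
def hankelOpen (n d : ℕ) : Set (Form n d) :=
  {f | eval (fun m => coeff m.1 (f : Poly n)) (hankelDet n d) ≠ 0}

theorem hankelOpen_isZariskiOpen (n d : ℕ) : IsZariskiOpen (hankelOpen n d) :=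
  ⟨{hankelDet n d}, by ext f; simp [hankelOpen]⟩

theorem hankelOpen_nonempty (n d : ℕ) : (hankelOpen n d).Nonempty := by
  refine ⟨gridForm n d, ?_⟩
  change eval _ _ ≠ 0
  rw [eval_hankelDet]
  exact Finset.prod_ne_zero_iff.2 fun k _ => det_hankelAt_gridForm_ne_zero _

theorem h_eq_of_mem_hankelOpen {n d k : ℕ} {f : Form n d} (hf : f ∈ hankelOpen n d)
    (hk : 2 * k ≤ d) : h k (f : Poly n) = Module.finrank ℂ (Form n k) := by
  change eval _ _ ≠ 0 at hf
  rw [eval_hankelDet] at hf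
  exact h_eq_finrank_of_det_ne_zero hk f
    (Finset.prod_ne_zero_iff.1 hf ⟨k, by omega⟩ (Finset.mem_univ _))

theorem hankelOpen_isHilbertOpen (n d : ℕ) : IsHilbertOpen (hankelOpen n d) where
  isOpen := hankelOpen_isZariskiOpen n d
  nonempty := hankelOpen_nonempty n d
  constant f hf g hg := by
    funext k
    change h k (f : Poly n) = h k (g : Poly n)
    have hkd : (k : ℕ) ≤ d := by omega
    by_cases hk : 2 * (k : ℕ) ≤ d
    · rw [h_eq_of_mem_hankelOpen hf hk, h_eq_of_mem_hankelOpen hg hk]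
    · have hk' : 2 * (d - (k : ℕ)) ≤ d := by omega
      rw [h_symm f.2 hkd, h_symm g.2 hkd, h_eq_of_mem_hankelOpen hf hk',
        h_eq_of_mem_hankelOpen hg hk']

/-- The constant value on `U` can be read off at a point shared with `hankelOpen`. -/
theorem IsHilbertOpen.h_eq {n d k : ℕ} {U : Set (Form n d)} (hU : IsHilbertOpen U)
    {f : Form n d} (hf : f ∈ U) (hk : 2 * k ≤ d) :
    h k (f : Poly n) = Module.finrank ℂ (Form n k) := by
  obtain ⟨g, hgU, hg⟩ := hU.isOpen.inter_nonempty (hankelOpen_isZariskiOpen n d) hU.nonempty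
    (hankelOpen_nonempty n d)
  rw [← h_eq_of_mem_hankelOpen hg hk]
  exact congrFun (hU.constant f hf g hgU) ⟨k, by omega⟩

/-! ### The Fermat form -/

theorem X_mul_X_mem_Ann_fermat {n d : ℕ} {i j : Fin (n + 1)} (hij : i ≠ j) :
    X i * X j ∈ Ann (fermat n d : Poly n) := by
  rw [mem_Ann_iff, diffOp_mul_apply, diffOp_X, diffOp_X]
  simp only [fermat, map_sum]
  refine Finset.sum_eq_zero fun l _ => ?_
  rw [pderiv_pow]
  by_cases hl : l = j
  · subst hl
    simp [pderiv_X_of_ne hij.symm]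
  · simp [pderiv_X_of_ne hl]

theorem h_two_fermat_ne {n d : ℕ} (hn : 1 ≤ n) :
    h 2 (fermat n d : Poly n) ≠ Module.finrank ℂ (Form n 2) := by
  rw [ne_eq, h_eq_finrank_iff]
  intro hinj
  have hne : (0 : Fin (n + 1)) ≠ Fin.last n := by
    intro h
    have := congrArg Fin.val h
    simp at this
    omega
  have := hinj ⟨X 0 * X (Fin.last n), (isHomogeneous_X ℂ _).mul (isHomogeneous_X ℂ _)⟩
    (X_mul_X_mem_Ann_fermat hne)
  exact mul_ne_zero (X_ne_zero _) (X_ne_zero _) (congrArg Subtype.val this)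

end MacaulayDual

end

theorem proposition3p3 (n d : ℕ) (hd : 1 ≤ d) :
    (∃ U : Set (MacaulayDual.Form n d), MacaulayDual.IsHilbertOpen U) ∧
    ∀ U : Set (MacaulayDual.Form n d), MacaulayDual.IsHilbertOpen U →
      (∀ f ∈ U,
        (∀ k : ℕ, 2 * k ≤ d →
          MacaulayDual.h k (f : MacaulayDual.Poly n) =
              Module.finrank ℂ (MacaulayDual.Form n k) ∧
          Module.finrank ℂ (MacaulayDual.Form n k) = (n + k).choose n) ∧
        (∀ k : ℕ, d < 2 * k → k ≤ d →
          MacaulayDual.h k (f : MacaulayDual.Poly n) =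
              MacaulayDual.h (d - k) (f : MacaulayDual.Poly n) ∧
          MacaulayDual.h (d - k) (f : MacaulayDual.Poly n) = (n + (d - k)).choose n)) ∧
      (1 ≤ n → 4 ≤ d → MacaulayDual.fermat n d ∉ U) := by
  refine ⟨⟨_, MacaulayDual.hankelOpen_isHilbertOpen n d⟩, fun U hU => ⟨fun f hf => ⟨?_, ?_⟩, ?_⟩⟩
  · exact fun k hk => ⟨hU.h_eq hf hk, MacaulayDual.finrank_form n k⟩
  · intro k hk hkd
    refine ⟨MacaulayDual.h_symm f.2 hkd, ?_⟩
    rw [hU.h_eq hf (by omega), MacaulayDual.finrank_form]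
  · intro hn hd4 hF
    -- The bound `4 ≤ d` is what puts `k = 2` in the range `2 * k ≤ d`.
    exact MacaulayDual.h_two_fermat_ne hn (hU.h_eq hF (by omega))
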